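/- Consider a two-level call center. Level $1$ has $N$ servers and level $2$ has $C_2^N$ servers, where $\lim_{N\to\infty} C_2^N/N = r$ for some $r>0$. An infinite queue of jobs waits at level $1$: each time a server of level $1$ is free it takes a new job, which is of class $0$ (urgent) with probability $p\in[0,1]$ and of class $1$ with probability $1-p$. A class $i$ job is served at level $1$ with rate $\mu_{i1}>0$. A class $1$ job then leaves; a class $0$ job then goes to a server of level $2$, where it is served with rate $\mu_{02}>0$, if one is idle, and otherwise stays at level $1$ and blocks its server until a server of level $2$ becomes available. Let $Y_*^N(t)$ be the number of blocked class $0$ jobs at level $1$, $Y^N(t)$ the number of class $0$ jobs in service at level $1$, and $Z^N(t)$ the number of idle servers at level $2$. Precisely, $(Y_*^N(t),Y^N(t),Z^N(t))_{t\ge 0}$ is the càdlàg Markov jump process on $$\{(y_*,y,z)\in\mathbb N^3:\ y+y_*\le N,\ z\le C_2^N,\ y_* z=0\}$$ that jumps from $(y_*,y,z)$ to $$\begin{cases} (y_*+1,y-1,0) & \text{at rate } \mu_{01}\,y\,\mathbf 1_{\{z=0\}},\\ (0,y-1,z-1) & \text{at rate } \mu_{01}\,y\,(1-p)\,\mathbf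 1_{\{z>0\}},\\ (0,y,z-1) & \text{at rate } \mu_{01}\,y\,p\,\mathbf 1_{\{z>0\}},\\ (y_*,y+1,z) & \text{at rate } \mu_{11}\,p\,(N-y_*-y),\\ (y_*-1,y,z) & \text{at rate } (1-p)\,\mu_{02}\,C_2^N\,\mathbf 1_{\{y_*>0\}},\\ (y_*-1,y+1,z) & \text{at rate } p\,\mu_{02}\,C_2^N\,\mathbf 1_{\{y_*>0\}},\\ (0,y,z+1) & \text{at rate } \mu_{02}\,(C_2^N-z)\,\mathbf 1_{\{y_*=0\}}. \end{cases}$$ Let $$r_c=\frac{p}{\mu_{02}}\Big/\Big(\frac{p}{\mu_{01}}+\frac{1-p}{\mu_{11}}\Big)$$ and assume $r>r_c$ (underloaded regime). Then there is $t_1>0$ such that, for every sequence of deterministic initial states for which $$\lim_{N\to\infty}\frac1N\big(Y_*^N(0),Y^N(0),Z^N(0)\big)=x_0$$ for some $x_0\in[0,1]^2\times[0,r]$, and for every $T>t_1$, $$\lim_{N\to\infty}\mathbb P\big(Y_*^N(t)=0\ \text{for all } t\in[t_1,T]\big)=1 .$$ The time $t_1$ does not depend on the initial states, on $x_0$ or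 on $T$. -/

import Mathlib

open Filter Topology MeasureTheory
open scoped NNReal

namespace CallCenter

/-! ### Markov jump processes on a finite state space -/

section Markov

variable {S : Type*} [Fintype S] [DecidableEq S]

/-- The `Q`-matrix of the jump rates `q`: the entry at `(x, y)` with `x ≠ y` is the rate `q x y` of
the jump from `x` to `y`, and the diagonal makes the rows sum to zero. -/
def generator (q : S → S → ℝ) : Matrix S S ℝ :=
  Matrix.of fun x y => q x y - if x = y then ∑ z, q x z else 0

/-- The transition matrix `exp (t Q)` over a time span `t`. -/
noncomputable def transitionMatrix (q : S → S → ℝ) (t : ℝ≥0) : Matrix S S ℝ :=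
  NormedSpace.exp ((t : ℝ) • generator q)

/-- `X` is, under the probability `P`, a (càdlàg) Markov jump process on the finite state space `S`
with jump rates `q` and initial state `x₀`. -/
structure IsMarkovJumpProcess {Ω : Type*} [MeasurableSpace Ω] [MeasurableSpace S]
    (q : S → S → ℝ) (x₀ : S) (P : Measure Ω) (X : ℝ≥0 → Ω → S) : Prop where
  measurable : ∀ t, Measurable (X t)
  /-- Paths are right-continuous for the discrete topology. -/
  right_continuous : ∀ ω, ∀ t, ∀ᶠ s in 𝓝[≥] t, X s ω = X t ω
  /-- Paths have left limits for the discrete topology. -/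
  left_limits : ∀ ω, ∀ t, ∃ x, ∀ᶠ s in 𝓝[<] t, X s ω = x
  /-- Finite-dimensional distributions: the process starts at `x₀`, and, given the past, it moves
  from `x` to `y` during a time span `t` with probability `exp (t Q) x y`. -/
  finite_dimensional : ∀ (n : ℕ) (t : ℕ → ℝ≥0), Monotone t → t 0 = 0 → ∀ x : ℕ → S,
    P.real {ω | ∀ i ≤ n, X (t i) ω = x i} =
      (if x 0 = x₀ then 1 else 0) *
        ∏ i ∈ Finset.range n, transitionMatrix q (t (i + 1) - t i) (x i) (x (i + 1))

end Markov

/-! ### The two-level call center -/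

/-- The states `(y_*, y, z)` of a call center with `C₁` servers at level 1 and `C₂` servers at
level 2: `y_*` blocked urgent (class 0) jobs at level 1, `y` urgent jobs in service at level 1,
and `z` idle servers at level 2. -/
def stateSpace (C₁ C₂ : ℕ) : Finset (ℕ × ℕ × ℕ) :=
  {x ∈ Finset.range (C₁ + 1) ×ˢ Finset.range (C₁ + 1) ×ˢ Finset.range (C₂ + 1) |
    x.2.1 + x.1 ≤ C₁ ∧ x.2.2 ≤ C₂ ∧ x.1 * x.2.2 = 0}

theorem mem_stateSpace {C₁ C₂ ys y z : ℕ} :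
    (ys, y, z) ∈ stateSpace C₁ C₂ ↔ y + ys ≤ C₁ ∧ z ≤ C₂ ∧ ys * z = 0 := by
  simp only [stateSpace, Finset.mem_filter, Finset.mem_product, Finset.mem_range]
  constructor
  · rintro ⟨-, h⟩; exact h
  · rintro ⟨h₁, h₂, h₃⟩; exact ⟨⟨by omega, by omega, by omega⟩, h₁, h₂, h₃⟩

/-- Number `y_*` of blocked urgent jobs at level 1. -/
def blocked (x : ℕ × ℕ × ℕ) : ℕ := x.1

/-- Number `y` of urgent jobs in service at level 1. -/
def inService (x : ℕ × ℕ × ℕ) : ℕ := x.2.1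

/-- Number `z` of idle servers at level 2. -/
def idle (x : ℕ × ℕ × ℕ) : ℕ := x.2.2

/-- The rate of the jump from `(y_*, y, z)` to `(y_*', y', z')`. The seven kinds of jumps have
pairwise distinct displacements, so at most one summand is nonzero. -/
noncomputable def jumpRate (p μ₀₁ μ₁₁ μ₀₂ : ℝ) (C₁ C₂ : ℕ) (a b : ℕ × ℕ × ℕ) : ℝ :=
  match a, b with
  | (ys, y, z), (ys', y', z') =>
    -- an urgent job ends its service at level 1 and is blocked, level 2 being full
    (if z = 0 ∧ ys' = ys + 1 ∧ y' + 1 = y ∧ z' = 0 then μ₀₁ * y else 0)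
    -- an urgent job moves to level 2 and is replaced by a non-urgent one
    + (if 0 < z ∧ ys' = 0 ∧ y' + 1 = y ∧ z' + 1 = z then μ₀₁ * y * (1 - p) else 0)
    -- an urgent job moves to level 2 and is replaced by an urgent one
    + (if 0 < z ∧ ys' = 0 ∧ y' = y ∧ z' + 1 = z then μ₀₁ * y * p else 0)
    -- a non-urgent job ends its service and is replaced by an urgent one
    + (if ys' = ys ∧ y' = y + 1 ∧ z' = z then μ₁₁ * p * ((C₁ : ℝ) - ys - y) else 0)
    -- a job leaves level 2, a blocked job moves there and is replaced by a non-urgent one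
    + (if 0 < ys ∧ ys' + 1 = ys ∧ y' = y ∧ z' = z then (1 - p) * μ₀₂ * C₂ else 0)
    -- a job leaves level 2, a blocked job moves there and is replaced by an urgent one
    + (if 0 < ys ∧ ys' + 1 = ys ∧ y' = y + 1 ∧ z' = z then p * μ₀₂ * C₂ else 0)
    -- a job leaves level 2 and no job is blocked
    + (if ys = 0 ∧ ys' = 0 ∧ y' = y ∧ z' = z + 1 then μ₀₂ * ((C₂ : ℝ) - z) else 0)

/-- `X` is the state process `(Y_*, Y, Z)` of the call center with `C₁` servers at level 1 and `C₂`
servers at level 2, started at `x₀`. -/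
def IsCallCenterProcess {Ω : Type*} [MeasurableSpace Ω] (p μ₀₁ μ₁₁ μ₀₂ : ℝ) (C₁ C₂ : ℕ)
    (x₀ : stateSpace C₁ C₂) (P : Measure Ω) (X : ℝ≥0 → Ω → stateSpace C₁ C₂) : Prop :=
  IsMarkovJumpProcess (fun a b : stateSpace C₁ C₂ => jumpRate p μ₀₁ μ₁₁ μ₀₂ C₁ C₂ a.1 b.1) x₀ P X

/-- The critical ratio `r_c` of the capacities of the two levels. -/
noncomputable def criticalRatio (p μ₀₁ μ₁₁ μ₀₂ : ℝ) : ℝ :=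
  (p / μ₀₂) / (p / μ₀₁ + (1 - p) / μ₁₁)

end CallCenter

/-! Let `u`, `y`, `z` be the blocked jobs, the urgent jobs in service and the idle servers, divided
by `N`, and let `a = μ₁₁ p`, `c = μ₀₁`, `d = μ₀₂`. The functionals `s = y + p u` and `B = u - z`
have drifts free of boundary indicators: `a (1 - u - y) - (1 - p) c y` and `c y - d (r - z)`, the
latter with `r` in place of `C₂ / N`. For `m = a / c + 1 - p` the variable `y` cancels from the
drift of `s + m B`, which is `a - a u - m d (r - z)`. With no idle server this is at most `-κ`,
where `κ = m d r - a`, and `κ > 0` says exactly that `r > r_c`. With idle servers `u = 0`, and `s`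
has drift `a - m c y`, negative as soon as `y` is near or above `d r / c`. As `u z = 0`, the sign of
`B` tells the two cases apart, so `V = max s (s + m B)` is a Lyapunov function: it falls at a
definite speed to strictly below `d r / c`. From then on the inflow `c y` to level 2 is below its
capacity `d r`, so `B` becomes negative, a positive fraction of level 2 is idle and `u = 0`. The
times involved depend only on a priori bounds for `V` and `B`, hence not on the initial state. This
is `exists_time_forall_blocked_eq_zero`, stated with an error tolerance `η`. For the random process,
sampled with mesh `T / 2 ^ n`, the martingale parts of `s` and `B` stay below a small multiple of
`N` with probability `1 - O(1 / N)`, with a bound free of `n` (`IsMarkovChain.kolmogorov`). Once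
they are subtracted, the deterministic statement applies. Right continuity passes from the dyadic
grids to all times. -/

namespace CallCenter

/-! ### Short-time behaviour of the transition semigroup -/

section TransitionMatrix

variable {S : Type*} [Fintype S] [DecidableEq S]

theorem generator_mulVec (q : S → S → ℝ) (g : S → ℝ) (x : S) :
    (generator q).mulVec g x = ∑ y, q x y * (g y - g x) := by
  simp only [Matrix.mulVec, dotProduct, generator, Matrix.of_apply, sub_mul, ite_mul, zero_mul,
    Finset.sum_sub_distrib, mul_sub, Finset.sum_ite_eq, Finset.mem_univ, if_true, Finset.sum_mul]

theorem hasDerivAt_exp_smul_mulVec (Q : Matrix S S ℝ) (g : S → ℝ) (x : S) (t : ℝ) :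
    HasDerivAt (fun h : ℝ => (NormedSpace.exp (h • Q)).mulVec g x)
      ((NormedSpace.exp (t • Q) * Q).mulVec g x) t := by
  let _ : NormedRing (Matrix S S ℝ) := Matrix.linftyOpNormedRing
  let _ : NormedAlgebra ℝ (Matrix S S ℝ) := Matrix.linftyOpNormedAlgebra
  have h := hasDerivAt_exp_smul_const (𝕂 := ℝ) Q t
  let ℓ : Matrix S S ℝ →ₗ[ℝ] ℝ :=
    { toFun := fun A => A.mulVec g x
      map_add' := fun A B => by simp [Matrix.add_mulVec]
      map_smul' := fun r A => by simp [Matrix.smul_mulVec] }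
  exact (LinearMap.toContinuousLinearMap ℓ).hasFDerivAt.comp_hasDerivAt t h

/-- The derivative of `exp (t Q) 1` is `exp (t Q) Q 1 = 0`, because the rows of `Q` sum to zero. -/
theorem sum_transitionMatrix (q : S → S → ℝ) (t : ℝ≥0) (x : S) :
    ∑ y, transitionMatrix q t x y = 1 := by
  have hd : ∀ s : ℝ, HasDerivAt
      (fun h : ℝ => (NormedSpace.exp (h • generator q)).mulVec (fun _ => (1 : ℝ)) x) 0 s := by
    intro s
    have h := hasDerivAt_exp_smul_mulVec (generator q) (fun _ => (1 : ℝ)) x s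
    rw [← Matrix.mulVec_mulVec] at h
    have h0 : (generator q).mulVec (fun _ => (1 : ℝ)) = 0 := by
      ext y; rw [generator_mulVec]; simp
    rwa [h0, Matrix.mulVec_zero] at h
  have hc := is_const_of_deriv_eq_zero (fun s => (hd s).differentiableAt)
    (fun s => (hd s).deriv) t 0
  simpa [transitionMatrix, Matrix.mulVec, dotProduct, Matrix.one_apply] using hc

theorem eventually_transitionMatrix_mulVec_le (q : S → S → ℝ) (g : S → ℝ) {ε : ℝ} (hε : 0 < ε) :
    ∀ᶠ h : ℝ≥0 in 𝓝 0, ∀ x,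
      |(transitionMatrix q h).mulVec g x - g x - h * (generator q).mulVec g x| ≤ ε * h := by
  rw [eventually_all]
  intro x
  have hd := hasDerivAt_exp_smul_mulVec (generator q) g x 0
  rw [hasDerivAt_iff_isLittleO_nhds_zero] at hd
  have h1 := hd.def hε
  have h2 : Tendsto (fun h : ℝ≥0 => (h : ℝ)) (𝓝 0) (𝓝 0) :=
    NNReal.tendsto_coe.2 tendsto_id
  filter_upwards [h2.eventually h1] with h hh
  simpa [transitionMatrix] using hh

end TransitionMatrix

/-! ### Martingale inequality for finite Markov chains -/

section Chain

/-- `Y` is, under `P`, a Markov chain with transition matrix `K` and initial state `x₀`. -/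
structure IsMarkovChain {S Ω : Type*} [DecidableEq S] [MeasurableSpace S] [MeasurableSpace Ω]
    (K : Matrix S S ℝ) (x₀ : S) (P : Measure Ω) (Y : ℕ → Ω → S) : Prop where
  measurable : ∀ n, Measurable (Y n)
  finite_dimensional : ∀ (n : ℕ) (x : ℕ → S), P.real {ω | ∀ i ≤ n, Y i ω = x i} =
    (if x 0 = x₀ then 1 else 0) * ∏ i ∈ Finset.range n, K (x i) (x (i + 1))

theorem measurable_path_fin {S Ω : Type*} [MeasurableSpace S] [MeasurableSpace Ω]
    {Y : ℕ → Ω → S} (hm : ∀ n, Measurable (Y n)) (n : ℕ) :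
    Measurable fun ω (i : Fin (n + 1)) => Y i ω :=
  measurable_pi_lambda _ fun i => hm i

/-- A function of the path up to time `n` factors through the finite path. -/
theorem eq_of_dependsOn {S : Type*} {G : (ℕ → S) → ℝ} {n : ℕ} (hG : DependsOn G (Set.Iic n)) (w : ℕ → S) :
    G w = G fun k => (fun i : Fin (n + 1) => w i) (Fin.ofNat (n + 1) (min k n)) := by
  refine hG fun i hi => ?_
  have : i ≤ n := hi
  simp [Nat.mod_eq_of_lt (Nat.lt_succ_of_le this), this]

theorem integrable_dependsOn {S Ω : Type*} [Fintype S] [MeasurableSpace S]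
    [MeasurableSingletonClass S] [MeasurableSpace Ω] {P : Measure Ω} [IsProbabilityMeasure P]
    {Y : ℕ → Ω → S} (hm : ∀ n, Measurable (Y n)) {G : (ℕ → S) → ℝ} {n : ℕ}
    (hG : DependsOn G (Set.Iic n)) : Integrable (fun ω => G fun i => Y i ω) P := by
  have h := measurable_path_fin hm n
  have h2 : (fun ω => G fun i => Y i ω) =
      (fun x : Fin (n + 1) → S => G fun k => x (Fin.ofNat (n + 1) (min k n))) ∘
        fun ω (i : Fin (n + 1)) => Y i ω := by
    funext ω
    exact eq_of_dependsOn hG _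
  rw [h2]
  have := Measure.isProbabilityMeasure_map (μ := P) h.aemeasurable
  exact (Integrable.of_finite (μ := P.map _)).comp_measurable h

variable {S Ω : Type*} [Fintype S] [DecidableEq S] [MeasurableSpace S] [MeasurableSingletonClass S]
  [MeasurableSpace Ω] {K : Matrix S S ℝ} {x₀ : S} {P : Measure Ω} [IsProbabilityMeasure P]
  {Y : ℕ → Ω → S}

/-- The Markov property for one step. -/
theorem IsMarkovChain.integral_step (hY : IsMarkovChain K x₀ P Y) {n : ℕ} {G : (ℕ → S) → ℝ}
    (hG : DependsOn G (Set.Iic n)) (H : S → S → ℝ) :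
    ∫ ω, G (fun i => Y i ω) * H (Y n ω) (Y (n + 1) ω) ∂P =
      ∫ ω, G (fun i => Y i ω) * ∑ y, K (Y n ω) y * H (Y n ω) y ∂P := by
  -- The path up to time `n` takes finitely many values, which `e` extends to infinite sequences
  -- constant after `n`. Both integrals thus become finite sums over such paths.
  set π : Ω → (Fin (n + 1) → S) := fun ω i => Y i ω with hπ
  have hπm : Measurable π := measurable_path_fin hY.measurable n
  set e : (Fin (n + 1) → S) → ℕ → S := fun x k => x (Fin.ofNat (n + 1) (min k n)) with he
  have hGe : ∀ ω, G (fun i => Y i ω) = G (e (π ω)) := fun ω => eq_of_dependsOn hG _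
  have hYe : ∀ ω, Y n ω = e (π ω) n := by
    intro ω; simp [e, π]
  have hset : ∀ x, π ⁻¹' {x} = {ω | ∀ i ≤ n, Y i ω = e x i} := by
    intro x
    ext ω
    simp only [Set.mem_preimage, Set.mem_singleton_iff, Set.mem_ofPred_eq, funext_iff, π, e]
    constructor
    · intro h i hi
      have := h (Fin.ofNat (n + 1) (min i n))
      simpa [Nat.mod_eq_of_lt (Nat.lt_succ_of_le hi), hi] using this
    · intro h i
      have hi := Nat.le_of_lt_succ i.2
      rw [h i hi]
      congr 1
      ext
      simp [hi]
  have hprob2 : ∀ x y, P.real ((fun ω => (π ω, Y (n + 1) ω)) ⁻¹' {(x, y)}) =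
      P.real (π ⁻¹' {x}) * K (e x n) y := by
    intro x y
    have h1 : (fun ω => (π ω, Y (n + 1) ω)) ⁻¹' {(x, y)} =
        {ω | ∀ i ≤ n + 1, Y i ω = (if i ≤ n then e x i else y)} := by
      ext ω
      have h2 := congrArg (fun s => ω ∈ s) (hset x)
      simp only [Set.mem_preimage, Set.mem_singleton_iff, Prod.mk.injEq, Set.mem_ofPred_eq] at h2 ⊢
      rw [h2]
      constructor
      · rintro ⟨h, h'⟩ i hi
        split_ifs with hin
        · exact h i hin
        · rw [show i = n + 1 by omega, h']
      · intro h
        refine ⟨fun i hi => by rw [h i (by omega), if_pos hi], ?_⟩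
        rw [h (n + 1) le_rfl, if_neg (by omega)]
    rw [h1, hset, hY.finite_dimensional, hY.finite_dimensional, Finset.prod_range_succ, mul_assoc]
    congr 1
    congr 1
    · refine Finset.prod_congr rfl fun i hi => ?_
      have := Finset.mem_range.1 hi
      rw [if_pos (by omega), if_pos (by omega)]
    · simp
  have hpair : Measurable fun ω => (π ω, Y (n + 1) ω) := hπm.prodMk (hY.measurable (n + 1))
  have := Measure.isProbabilityMeasure_map (μ := P) hπm.aemeasurable
  have := Measure.isProbabilityMeasure_map (μ := P) hpair.aemeasurable
  have hl : ∫ ω, G (fun i => Y i ω) * H (Y n ω) (Y (n + 1) ω) ∂P =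
      ∑ xy : (Fin (n + 1) → S) × S, P.real (π ⁻¹' {xy.1}) * K (e xy.1 n) xy.2 *
        (G (e xy.1) * H (e xy.1 n) xy.2) := by
    simp only [hGe, hYe]
    rw [← integral_map (φ := fun ω => (π ω, Y (n + 1) ω))
      (f := fun xy => G (e xy.1) * H (e xy.1 n) xy.2) hpair.aemeasurable
      (Integrable.of_finite (μ := P.map _)).aestronglyMeasurable,
      integral_fintype Integrable.of_finite]
    refine Finset.sum_congr rfl fun xy _ => ?_
    rw [map_measureReal_apply hpair (measurableSet_singleton _), ← hprob2, smul_eq_mul]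
  have hr : ∫ ω, G (fun i => Y i ω) * ∑ y, K (Y n ω) y * H (Y n ω) y ∂P =
      ∑ x : Fin (n + 1) → S, P.real (π ⁻¹' {x}) *
        (G (e x) * ∑ y, K (e x n) y * H (e x n) y) := by
    simp only [hGe, hYe]
    rw [← integral_map (φ := π)
      (f := fun x => G (e x) * ∑ y, K (e x n) y * H (e x n) y) hπm.aemeasurable
      (Integrable.of_finite (μ := P.map _)).aestronglyMeasurable,
      integral_fintype Integrable.of_finite]
    refine Finset.sum_congr rfl fun x _ => ?_
    rw [map_measureReal_apply hπm (measurableSet_singleton _), smul_eq_mul]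
  rw [hl, hr, Fintype.sum_prod_type]
  refine Finset.sum_congr rfl fun x _ => ?_
  simp only [Finset.mul_sum]
  exact Finset.sum_congr rfl fun y _ => by ring

/-- The increments of the martingale part of `f` along the path `w` of a Markov chain. -/
def martingaleIncrement (K : Matrix S S ℝ) (f : S → ℝ) (w : ℕ → S) (i : ℕ) : ℝ :=
  f (w (i + 1)) - K.mulVec f (w i)

/-- Kolmogorov's inequality for the martingale part of a function of a Markov chain. -/
theorem IsMarkovChain.kolmogorov (hY : IsMarkovChain K x₀ P Y) (hK : ∀ x, ∑ y, K x y = 1)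
    (f : S → ℝ) {σ : ℝ} (hσ0 : 0 ≤ σ)
    (hσ : ∀ x, ∑ y, K x y * (f y - K.mulVec f x) ^ 2 ≤ σ) {l : ℝ}
    (hl : 0 < l) (n : ℕ) :
    P.real {ω | ∃ j ≤ n, l ≤ |∑ i ∈ Finset.range j, martingaleIncrement K f (fun k => Y k ω) i|} ≤
      n * σ / l ^ 2 := by
  classical
  set D : (ℕ → S) → ℕ → ℝ := martingaleIncrement K f with hD
  -- `M` is the martingale stopped when it first leaves `(-l, l)`, so that Chebyshev's inequality
  -- for `M n` alone controls the maximum up to time `n`.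
  set good : ℕ → (ℕ → S) → Prop := fun n w => ∀ j ≤ n, |∑ i ∈ Finset.range j, D w i| < l
    with hgood
  set M : ℕ → (ℕ → S) → ℝ := fun n w => ∑ i ∈ Finset.range n, if good i w then D w i else 0
    with hM
  have hDdep : ∀ (w w' : ℕ → S) (n : ℕ), (∀ i ∈ Set.Iic n, w i = w' i) → ∀ i < n,
      D w i = D w' i := by
    intro w w' n h i hi
    simp only [hD, martingaleIncrement]
    rw [h i hi.le, h (i + 1) hi]
  have hgdep : ∀ (w w' : ℕ → S) (n : ℕ), (∀ i ∈ Set.Iic n, w i = w' i) →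
      (good n w ↔ good n w') := by
    intro w w' n h
    refine forall₂_congr fun j hj => ?_
    rw [Finset.sum_congr rfl fun i hi =>
      hDdep w w' n h i ((Finset.mem_range.1 hi).trans_le hj)]
  have hMdep : ∀ n, DependsOn (M n) (Set.Iic n) := by
    intro n w w' h
    refine Finset.sum_congr rfl fun i hi => ?_
    have hi := Finset.mem_range.1 hi
    rw [hDdep w w' n h i hi, if_congr (hgdep w w' i fun j hj => h j (le_trans hj hi.le)) rfl rfl]
  have hint : ∀ n, Integrable (fun ω => M n (fun i => Y i ω) ^ 2) P := fun n =>
    integrable_dependsOn (G := fun w => M n w ^ 2) (n := n) hY.measurable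
      fun w w' h => by simp only [hMdep n h]
  have hbound : ∀ n : ℕ, ∫ ω, M n (fun i => Y i ω) ^ 2 ∂P ≤ n * σ := by
    intro n
    induction n with
    | zero => simp [hM]
    | succ n ih =>
      have hG1 : DependsOn (fun w => if good n w then 2 * M n w else 0) (Set.Iic n) := by
        intro w w' h
        simp only [hMdep n h]
        rw [if_congr (hgdep w w' n h) rfl rfl]
      have hG2 : DependsOn (fun w => if good n w then (1 : ℝ) else 0) (Set.Iic n) := by
        intro w w' h
        simp only
        rw [if_congr (hgdep w w' n h) rfl rfl]
      have h1 := hY.integral_step hG1 fun x y => f y - K.mulVec f x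
      have h2 := hY.integral_step hG2 fun x y => (f y - K.mulVec f x) ^ 2
      -- Increments have conditional mean zero, so the cross term in the expansion of `M (n + 1) ^
      -- 2` integrates to zero.
      have hzero : ∀ x, ∑ y, K x y * (f y - K.mulVec f x) = 0 := by
        intro x
        simp only [mul_sub, Finset.sum_sub_distrib, ← Finset.sum_mul, hK, one_mul]
        simp [Matrix.mulVec, dotProduct]
      simp only [hzero, mul_zero, integral_zero] at h1
      have hmono : ∀ (G : (ℕ → S) → ℝ) (H : S → S → ℝ), DependsOn G (Set.Iic n) →
          Integrable (fun ω => G (fun i => Y i ω) * H (Y n ω) (Y (n + 1) ω)) P := by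
        intro G H hG
        refine integrable_dependsOn (G := fun w => G w * H (w n) (w (n + 1))) (n := n + 1)
          hY.measurable fun w w' h => ?_
        simp only
        rw [hG fun i hi => h i (le_trans hi (Nat.le_succ n)), h n (Nat.le_succ n),
          h (n + 1) (le_refl (n + 1))]
      have h3 : ∫ ω, (if good n (fun i => Y i ω) then (1 : ℝ) else 0) *
          ∑ y, K (Y n ω) y * (f y - K.mulVec f (Y n ω)) ^ 2 ∂P ≤ σ := by
        have h5 : ∫ ω, (if good n (fun i => Y i ω) then (1 : ℝ) else 0) *
          ∑ y, K (Y n ω) y * (f y - K.mulVec f (Y n ω)) ^ 2 ∂P ≤ ∫ _, σ ∂P := by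
          refine integral_mono (integrable_dependsOn (G := fun w =>
            (if good n w then (1 : ℝ) else 0) * ∑ y, K (w n) y * (f y - K.mulVec f (w n)) ^ 2)
            (n := n) hY.measurable fun w w' h => ?_) (integrable_const σ) fun ω => ?_
          · simp only
            rw [if_congr (hgdep w w' n h) rfl rfl, h n (le_refl n)]
          · simp only [ite_mul, one_mul, zero_mul]
            split_ifs
            · exact hσ _
            · exact hσ0
        simpa using h5
      have h4 : ∀ ω, M (n + 1) (fun i => Y i ω) ^ 2 = M n (fun i => Y i ω) ^ 2 +
          (if good n (fun i => Y i ω) then 2 * M n (fun i => Y i ω) else 0) *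
            (f (Y (n + 1) ω) - K.mulVec f (Y n ω)) +
          (if good n (fun i => Y i ω) then (1 : ℝ) else 0) *
            (f (Y (n + 1) ω) - K.mulVec f (Y n ω)) ^ 2 := by
        intro ω
        simp only [hM, Finset.sum_range_succ, hD, martingaleIncrement]
        split_ifs <;> ring
      simp only [h4]
      have hA := hmono _ (fun x y => f y - K.mulVec f x) hG1
      have hB := hmono _ (fun x y => (f y - K.mulVec f x) ^ 2) hG2
      rw [integral_add (Integrable.fun_add (hint n) hA) hB, integral_add (hint n) hA, h1, h2]
      push_cast
      linarith
  have hfrozen : ∀ (n : ℕ) (w : ℕ → S), (good n w → M n w = ∑ i ∈ Finset.range n, D w i) ∧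
      (¬ good n w → l ≤ |M n w|) := by
    intro n w
    induction n with
    | zero =>
      refine ⟨fun _ => by simp [hM], fun h => absurd (fun j hj => ?_) h⟩
      rw [Nat.le_zero.1 hj]
      simpa using hl
    | succ n ih =>
      have hsucc : M (n + 1) w = M n w + if good n w then D w n else 0 :=
        Finset.sum_range_succ _ _
      by_cases hn : good n w
      · have hM1 : M (n + 1) w = ∑ i ∈ Finset.range (n + 1), D w i := by
          rw [hsucc, if_pos hn, ih.1 hn, Finset.sum_range_succ]
        refine ⟨fun _ => hM1, fun hn1 => ?_⟩
        rw [hM1]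
        by_contra hlt
        push Not at hlt
        refine hn1 fun j hj => ?_
        rcases Nat.le_succ_iff.1 hj with h | h
        · exact hn j h
        · rwa [h]
      · refine ⟨fun hn1 => absurd (fun j hj => hn1 j (hj.trans (Nat.le_succ n))) hn, fun _ => ?_⟩
        rw [hsucc, if_neg hn, add_zero]
        exact ih.2 hn
  have hsub : {ω | ∃ j ≤ n, l ≤ |∑ i ∈ Finset.range j, D (fun k => Y k ω) i|} ⊆
      {ω | l ^ 2 ≤ M n (fun i => Y i ω) ^ 2} := by
    rintro ω ⟨j, hj, hlj⟩
    have hng : ¬ good n fun k => Y k ω := fun h => absurd (h j hj) (not_lt.2 hlj)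
    have := (hfrozen n _).2 hng
    have h2 := pow_le_pow_left₀ hl.le this 2
    rwa [sq_abs] at h2
  rw [le_div_iff₀ (by positivity), mul_comm]
  calc _ ≤ l ^ 2 * P.real {ω | l ^ 2 ≤ M n (fun i => Y i ω) ^ 2} :=
        mul_le_mul_of_nonneg_left (measureReal_mono hsub) (by positivity)
    _ ≤ ∫ ω, M n (fun i => Y i ω) ^ 2 ∂P :=
        mul_meas_ge_le_integral_of_nonneg (ae_of_all _ fun ω => by positivity) (hint n) _
    _ ≤ n * σ := hbound n

end Chain

/-! ### Drifts and total jump rate of the call center -/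

section JumpRate

/-- Each kind of jump has a single target `t`. The hypotheses are needed only for `r ≠ 0`: a target
that leaves the state space, or that involves a truncated subtraction, has rate zero. -/
theorem sum_ite_mul_eq {α : Type*} [DecidableEq α] (s : Finset α) (P : α → Prop) [DecidablePred P]
    (C : Prop) [Decidable C] (t : α) (r : ℝ) (g : α → ℝ) (hP : r ≠ 0 → ∀ b, P b ↔ C ∧ b = t)
    (ht : C → r ≠ 0 → t ∈ s) :
    ∑ b ∈ s, (if P b then r else 0) * g b = if C then r * g t else 0 := by
  by_cases hr : r = 0
  · simp [hr]
  simp only [hP hr, ite_mul, zero_mul]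
  by_cases hC : C
  · simp [hC, ht hC hr]
  · simp [hC]

theorem sum_jumpRate_mul (p μ₀₁ μ₁₁ μ₀₂ : ℝ) {C₁ C₂ u y z : ℕ} (h : (u, y, z) ∈ stateSpace C₁ C₂)
    (g : ℕ × ℕ × ℕ → ℝ) :
    ∑ b ∈ stateSpace C₁ C₂, jumpRate p μ₀₁ μ₁₁ μ₀₂ C₁ C₂ (u, y, z) b * g b =
      (if z = 0 then μ₀₁ * y * g (u + 1, y - 1, 0) else 0)
      + (if 0 < z then μ₀₁ * y * (1 - p) * g (0, y - 1, z - 1) else 0)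
      + (if 0 < z then μ₀₁ * y * p * g (0, y, z - 1) else 0)
      + μ₁₁ * p * ((C₁ : ℝ) - u - y) * g (u, y + 1, z)
      + (if 0 < u then (1 - p) * μ₀₂ * C₂ * g (u - 1, y, z) else 0)
      + (if 0 < u then p * μ₀₂ * C₂ * g (u - 1, y + 1, z) else 0)
      + (if u = 0 then μ₀₂ * ((C₂ : ℝ) - z) * g (0, y, z + 1) else 0) := by
  obtain ⟨h1, h2, h3⟩ := mem_stateSpace.1 h
  have huz : u = 0 ∨ z = 0 := mul_eq_zero.1 h3
  have hcast : ∀ {v : ℝ} {w : ℝ}, v * w ≠ 0 → w ≠ 0 := fun h => right_ne_zero_of_mul h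
  simp only [jumpRate, add_mul, Finset.sum_add_distrib]
  congr 1
  congr 1
  congr 1
  congr 1
  congr 1
  congr 1
  · rw [sum_ite_mul_eq _ _ (z = 0) (u + 1, y - 1, 0)]
    · rintro hr ⟨u', y', z'⟩
      have hy : y ≠ 0 := by rintro rfl; simp at hr
      simp only [Prod.mk.injEq]
      omega
    · intro hz hr
      have : y ≠ 0 := by rintro rfl; simp at hr
      exact mem_stateSpace.2 ⟨by omega, by omega, by simp⟩
  · rw [sum_ite_mul_eq _ _ (0 < z) (0, y - 1, z - 1)]
    · rintro hr ⟨u', y', z'⟩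
      have hy : y ≠ 0 := by rintro rfl; simp at hr
      simp only [Prod.mk.injEq]
      omega
    · intro hz hr
      exact mem_stateSpace.2 ⟨by omega, by omega, by simp⟩
  · rw [sum_ite_mul_eq _ _ (0 < z) (0, y, z - 1)]
    · rintro - ⟨u', y', z'⟩
      simp only [Prod.mk.injEq]
      omega
    · intro hz hr
      exact mem_stateSpace.2 ⟨by omega, by omega, by simp⟩
  · rw [sum_ite_mul_eq _ _ True (u, y + 1, z)]
    · simp
    · rintro - ⟨u', y', z'⟩
      simp only [Prod.mk.injEq]
      tauto
    · intro _ hr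
      have h4 := hcast hr
      have : u + y ≠ C₁ := by
        rintro rfl
        push_cast at h4
        exact h4 (by ring)
      exact mem_stateSpace.2 ⟨by omega, by omega, h3⟩
  · rw [sum_ite_mul_eq _ _ (0 < u) (u - 1, y, z)]
    · rintro - ⟨u', y', z'⟩
      simp only [Prod.mk.injEq]
      omega
    · intro hu hr
      have hz : z = 0 := by omega
      exact mem_stateSpace.2 ⟨by omega, by omega, by simp [hz]⟩
  · rw [sum_ite_mul_eq _ _ (0 < u) (u - 1, y + 1, z)]
    · rintro - ⟨u', y', z'⟩
      simp only [Prod.mk.injEq]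
      omega
    · intro hu hr
      have hz : z = 0 := by omega
      exact mem_stateSpace.2 ⟨by omega, by omega, by simp [hz]⟩
  · rw [sum_ite_mul_eq _ _ (u = 0) (0, y, z + 1)]
    · rintro - ⟨u', y', z'⟩
      simp only [Prod.mk.injEq]
    · intro hu hr
      have h4 := hcast hr
      have : z ≠ C₂ := by
        rintro rfl
        exact h4 (by ring)
      exact mem_stateSpace.2 ⟨by omega, by omega, by simp⟩

theorem jumpRate_nonneg {p μ₀₁ μ₁₁ μ₀₂ : ℝ} (hp : p ∈ Set.Icc (0 : ℝ) 1) (h₀₁ : 0 < μ₀₁)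
    (h₁₁ : 0 < μ₁₁) (h₀₂ : 0 < μ₀₂) {C₁ C₂ : ℕ} {a : ℕ × ℕ × ℕ} (ha : a ∈ stateSpace C₁ C₂)
    (b : ℕ × ℕ × ℕ) : 0 ≤ jumpRate p μ₀₁ μ₁₁ μ₀₂ C₁ C₂ a b := by
  obtain ⟨u, y, z⟩ := a
  obtain ⟨u', y', z'⟩ := b
  obtain ⟨h1, h2, -⟩ := mem_stateSpace.1 ha
  have h1' : (y : ℝ) + u ≤ C₁ := by exact_mod_cast h1
  have h2' : (z : ℝ) ≤ C₂ := by exact_mod_cast h2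
  have hp0 := hp.1
  have hp1 : 0 ≤ 1 - p := by linarith [hp.2]
  have h3 : 0 ≤ (C₁ : ℝ) - u - y := by linarith
  have h4 : 0 ≤ (C₂ : ℝ) - z := by linarith
  simp only [jumpRate]
  have key : ∀ (P : Prop) [Decidable P] (r : ℝ), 0 ≤ r → 0 ≤ if P then r else 0 := by
    intro P _ r hr
    split_ifs
    · exact hr
    · exact le_rfl
  refine add_nonneg (add_nonneg (add_nonneg (add_nonneg (add_nonneg (add_nonneg ?_ ?_) ?_) ?_) ?_)
    ?_) ?_ <;> exact key _ _ (by positivity)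

/-- Urgent jobs in service plus the mean number of those replacing the blocked ones. -/
noncomputable def urgentLoad (p : ℝ) (x : ℕ × ℕ × ℕ) : ℝ := inService x + p * blocked x

/-- Blocked jobs minus idle servers of level 2. -/
noncomputable def imbalance (x : ℕ × ℕ × ℕ) : ℝ := (blocked x : ℝ) - idle x

/-- The weight `p` removes the indicators. Releasing a blocked job changes the load by `-p` plus a
mean gain of `p`. The end of an urgent service changes it by `-(1 - p)` on average, whether the job
is blocked (`-1 + p`) or moves on and is replaced. -/
theorem sum_jumpRate_mul_urgentLoad (p μ₀₁ μ₁₁ μ₀₂ : ℝ) {C₁ C₂ : ℕ} {x : ℕ × ℕ × ℕ}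
    (hx : x ∈ stateSpace C₁ C₂) :
    ∑ b ∈ stateSpace C₁ C₂, jumpRate p μ₀₁ μ₁₁ μ₀₂ C₁ C₂ x b * (urgentLoad p b - urgentLoad p x) =
      μ₁₁ * p * (C₁ - blocked x - inService x) - (1 - p) * μ₀₁ * inService x := by
  obtain ⟨u, y, z⟩ := x
  obtain ⟨-, -, h3⟩ := mem_stateSpace.1 hx
  rw [sum_jumpRate_mul p μ₀₁ μ₁₁ μ₀₂ hx (fun b => urgentLoad p b - urgentLoad p (u, y, z))]
  simp only [urgentLoad, blocked, inService]
  rcases mul_eq_zero.1 h3 with rfl | rfl <;> rcases y with _ | y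
  all_goals
    try rcases z with _ | z
    try rcases u with _ | u
    all_goals
      simp
      try ring

/-- The end of an urgent service adds one, by blocking a job or by filling an idle server. A
departure from level 2 subtracts one in both regimes, at rate `μ₀₂ C₂` when jobs are blocked since
then `z = 0`. -/
theorem sum_jumpRate_mul_imbalance (p μ₀₁ μ₁₁ μ₀₂ : ℝ) {C₁ C₂ : ℕ} {x : ℕ × ℕ × ℕ}
    (hx : x ∈ stateSpace C₁ C₂) :
    ∑ b ∈ stateSpace C₁ C₂, jumpRate p μ₀₁ μ₁₁ μ₀₂ C₁ C₂ x b * (imbalance b - imbalance x) =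
      μ₀₁ * inService x - μ₀₂ * (C₂ - idle x) := by
  obtain ⟨u, y, z⟩ := x
  obtain ⟨-, -, h3⟩ := mem_stateSpace.1 hx
  rw [sum_jumpRate_mul p μ₀₁ μ₁₁ μ₀₂ hx (fun b => imbalance b - imbalance (u, y, z))]
  simp only [imbalance, blocked, inService, idle]
  rcases mul_eq_zero.1 h3 with rfl | rfl <;> rcases y with _ | y
  all_goals
    try rcases z with _ | z
    try rcases u with _ | u
    all_goals
      simp
      try ring

/-- The total jump rate is of the order of the size of the call center. -/
theorem sum_jumpRate_mul_le {p μ₀₁ μ₁₁ μ₀₂ : ℝ} (hp : p ∈ Set.Icc (0 : ℝ) 1) (h₀₁ : 0 < μ₀₁)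
    (h₁₁ : 0 < μ₁₁) (h₀₂ : 0 < μ₀₂) {C₁ C₂ : ℕ} {x : ℕ × ℕ × ℕ} (hx : x ∈ stateSpace C₁ C₂)
    {g : ℕ × ℕ × ℕ → ℝ}
    (hg : ∀ b ∈ stateSpace C₁ C₂, jumpRate p μ₀₁ μ₁₁ μ₀₂ C₁ C₂ x b ≠ 0 → g b ≤ 1) :
    ∑ b ∈ stateSpace C₁ C₂, jumpRate p μ₀₁ μ₁₁ μ₀₂ C₁ C₂ x b * g b ≤
      (μ₀₁ + μ₁₁) * C₁ + μ₀₂ * C₂ := by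
  have h1 : ∑ b ∈ stateSpace C₁ C₂, jumpRate p μ₀₁ μ₁₁ μ₀₂ C₁ C₂ x b * g b ≤
      ∑ b ∈ stateSpace C₁ C₂, jumpRate p μ₀₁ μ₁₁ μ₀₂ C₁ C₂ x b * (fun _ => (1 : ℝ)) b := by
    refine Finset.sum_le_sum fun b hb => ?_
    by_cases h0 : jumpRate p μ₀₁ μ₁₁ μ₀₂ C₁ C₂ x b = 0
    · simp [h0]
    · exact mul_le_mul_of_nonneg_left (hg b hb h0) (jumpRate_nonneg hp h₀₁ h₁₁ h₀₂ hx b)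
  refine h1.trans ?_
  obtain ⟨u, y, z⟩ := x
  obtain ⟨h2, h3, h4⟩ := mem_stateSpace.1 hx
  rw [sum_jumpRate_mul p μ₀₁ μ₁₁ μ₀₂ hx]
  have h2' : (y : ℝ) + u ≤ C₁ := by exact_mod_cast h2
  have hu : (0 : ℝ) ≤ u := u.cast_nonneg
  have hy : (0 : ℝ) ≤ y := y.cast_nonneg
  have hz : (0 : ℝ) ≤ z := z.cast_nonneg
  have ha : μ₁₁ * (p * ((C₁ : ℝ) - u - y)) ≤ μ₁₁ * C₁ := by
    refine mul_le_mul_of_nonneg_left ?_ h₁₁.le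
    exact (mul_le_of_le_one_left (by linarith) hp.2).trans (by linarith)
  have hc : μ₀₁ * y ≤ μ₀₁ * C₁ := mul_le_mul_of_nonneg_left (by linarith) h₀₁.le
  have hd : 0 ≤ μ₀₂ * z := by positivity
  have he : 0 ≤ μ₀₂ * C₂ := by positivity
  rcases mul_eq_zero.1 h4 with rfl | rfl
  · rcases z with _ | z
    · simp at *
      linarith
    · simp at *
      linarith
  · rcases u with _ | u
    · simp at *
      linarith
    · simp at *
      linarith

/-- With jumps of size at most one, the variance rate of either functional is at most the total jump
rate, of order `N`. -/
theorem abs_sub_le_one_of_jumpRate_ne_zero {p μ₀₁ μ₁₁ μ₀₂ : ℝ} (hp : p ∈ Set.Icc (0 : ℝ) 1)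
    {C₁ C₂ : ℕ} {x b : ℕ × ℕ × ℕ} (h : jumpRate p μ₀₁ μ₁₁ μ₀₂ C₁ C₂ x b ≠ 0)
    (hx : x ∈ stateSpace C₁ C₂) :
    |urgentLoad p b - urgentLoad p x| ≤ 1 ∧ |imbalance b - imbalance x| ≤ 1 := by
  obtain ⟨u, y, z⟩ := x
  obtain ⟨u', y', z'⟩ := b
  obtain ⟨-, -, h3⟩ := mem_stateSpace.1 hx
  have hp0 := hp.1
  have hp1 := hp.2
  have hcases : (u' = u + 1 ∧ y' + 1 = y ∧ z' = z) ∨ (u' = u ∧ y' + 1 = y ∧ z' + 1 = z) ∨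
      (u' = u ∧ y' = y ∧ z' + 1 = z) ∨ (u' = u ∧ y' = y + 1 ∧ z' = z) ∨
      (u' + 1 = u ∧ y' = y ∧ z' = z) ∨ (u' + 1 = u ∧ y' = y + 1 ∧ z' = z) ∨
      (u' = u ∧ y' = y ∧ z' = z + 1) := by
    by_contra hcon
    have huz := mul_eq_zero.1 h3
    apply h
    simp only [jumpRate]
    repeat rw [if_neg (by omega)]
    norm_num
  simp only [urgentLoad, imbalance, blocked, inService, idle, abs_le]
  rcases hcases with ⟨rfl, rfl, rfl⟩ | ⟨rfl, rfl, rfl⟩ | ⟨rfl, rfl, rfl⟩ | ⟨rfl, rfl, rfl⟩ |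
    ⟨rfl, rfl, rfl⟩ | ⟨rfl, rfl, rfl⟩ | ⟨rfl, rfl, rfl⟩ <;> push_cast <;>
    refine ⟨⟨?_, ?_⟩, ⟨?_, ?_⟩⟩ <;> linarith

end JumpRate

/-! ### Lyapunov argument for the perturbed fluid dynamics -/

section Deterministic

/-- A sequence that decreases by `h * κ` while it is above `θ`, and never increases by more than
`b`, ends up below `θ + b`. -/
theorem le_max_of_drift {V : ℕ → ℝ} {θ δ b : ℝ} {k n : ℕ} (hδ : 0 ≤ δ)
    (hdown : ∀ j, k ≤ j → j < n → θ ≤ V j → V (j + 1) ≤ V j - δ)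
    (hup : ∀ j, k ≤ j → j < n → V (j + 1) ≤ V j + b) :
    ∀ j, k ≤ j → j ≤ n → V j ≤ max (V k - (j - k : ℝ) * δ) (θ + b) := by
  intro j hj
  induction j, hj using Nat.le_induction with
  | base => intro _; simp
  | succ j hj ih =>
    intro hn
    have h1 := ih (by omega)
    push_cast
    by_cases hθ : θ ≤ V j
    · have h2 := hdown j hj (by omega) hθ
      rcases le_max_iff.1 h1 with h | h
      · exact le_max_of_le_left (by linarith)
      · exact le_max_of_le_right (by linarith)
    · have h2 := hup j hj (by omega)
      exact le_max_of_le_right (by linarith)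

set_option maxHeartbeats 1000000 in
/-- Trajectories of the rescaled call center that follow the drift up to an error `η`, up to the
time `n * h`, have no blocked jobs after a time `t₁`. -/
theorem exists_time_forall_blocked_eq_zero {a c d p r : ℝ} (ha : 0 ≤ a) (hc : 0 < c) (hd : 0 < d)
    (hp : p ∈ Set.Icc (0 : ℝ) 1) (hr : 0 < r) (hm : 0 < a / c + (1 - p))
    (hκ : a < (a / c + (1 - p)) * d * r) :
    ∃ t₁ > 0, ∃ η > 0, ∃ h₀ > 0, ∀ (h : ℝ) (n : ℕ) (u y z s B : ℕ → ℝ), 0 < h → h < h₀ →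
      (∀ j, 0 ≤ u j) → (∀ j, 0 ≤ y j) → (∀ j, 0 ≤ z j) → (∀ j, u j * z j = 0) →
      (∀ j, u j + y j ≤ 1) → (∀ j, z j ≤ r + 1) →
      (∀ j ≤ n, |s j - (y j + p * u j)| ≤ η) → (∀ j ≤ n, |B j - (u j - z j)| ≤ η) →
      (∀ j < n, s (j + 1) ≤ s j + h * (a * (1 - u j - y j) - (1 - p) * c * y j + η)) →
      (∀ j < n, B (j + 1) ≤ B j + h * (c * y j - d * (r - z j) + η)) →
      ∀ j ≤ n, t₁ ≤ j * h → u j = 0 := by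
  obtain ⟨hp0, hp1⟩ := hp
  set m : ℝ := a / c + (1 - p) with hmdef
  have hmc : m * c = a + (1 - p) * c := by rw [hmdef]; field_simp
  set κ : ℝ := m * d * r - a with hκdef
  have hκ0 : 0 < κ := by linarith
  -- Below, `yc` is the level at which the inflow `c y` equals the capacity `d r`. As `m c yc = a +
  -- κ`, the drift `a - m c y` of `s` at `u = 0` is still `-7κ/8` at `y = yc - δ`.
  set δ : ℝ := κ / (8 * (m * c)) with hδdef
  have hmc0 : 0 < m * c := by positivity
  have hδ0 : 0 < δ := by positivity
  have hmcδ : m * c * δ = κ / 8 := by rw [hδdef]; field_simp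
  set yc : ℝ := d * r / c with hycdef
  have hyc : c * yc = d * r := by rw [hycdef]; field_simp
  set δ₂ : ℝ := c * δ / (32 * d) with hδ₂def
  have hδ₂0 : 0 < δ₂ := by positivity
  have hδ₂d : d * δ₂ = c * δ / 32 := by rw [hδ₂def]; field_simp
  -- the admissible error
  obtain ⟨η, hη0, hη1, hηa, hηb, hηc, hηd, hηe⟩ : ∃ η > 0, η ≤ 1 ∧
      (m * c * (4 * m + 4) + 1) * η ≤ κ / 8 ∧ (3 * m * d + 1 + m) * η ≤ κ / 8 ∧
      η ≤ δ / 8 ∧ (d + 1) * η ≤ c * δ / 32 ∧ η ≤ δ₂ / 4 := by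
    have hev : ∀ (A ε : ℝ), 0 < ε → ∀ᶠ η : ℝ in 𝓝[>] 0, A * η ≤ ε := by
      intro A ε hε
      have : Tendsto (fun η : ℝ => A * η) (𝓝[>] 0) (𝓝 (A * 0)) :=
        (continuous_const.mul continuous_id).continuousAt.tendsto.mono_left nhdsWithin_le_nhds
      rw [mul_zero] at this
      exact (this.eventually (gt_mem_nhds hε)).mono fun _ h => le_of_lt h
    obtain ⟨η, h⟩ := ((eventually_mem_nhdsWithin (a := (0 : ℝ)) (s := Set.Ioi 0)).and
      ((hev 1 1 one_pos).and ((hev (m * c * (4 * m + 4) + 1) (κ / 8) (by positivity)).and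
      ((hev (3 * m * d + 1 + m) (κ / 8) (by positivity)).and
      ((hev 1 (δ / 8) (by positivity)).and ((hev (d + 1) (c * δ / 32) (by positivity)).and
      (hev 1 (δ₂ / 4) (by positivity)))))))).exists
    simp only [one_mul] at h
    exact ⟨η, h⟩
  -- `b` bounds the upward speed of `s`, `s + m B` and `B`, with room for `κ / 2` where needed; `h₀`
  -- makes one step `h * b` smaller than each margin.
  set b : ℝ := a + c + m * d * (r + 1) + d * (r + 1) + m + 1 + κ with hbdef
  have hb0 : 0 < b := by positivity
  have hbbd : ∀ x : ℝ, 0 < x → 0 < x / b := fun x hx => div_pos hx hb0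
  set h₀ : ℝ := min 1 (min (2 * m * η / b) (min (δ / 2 / b) (δ₂ / 4 / b))) with hh₀def
  set t₂ : ℝ := 2 * (2 + 2 * m) / κ with ht₂def
  have ht₂0 : 0 < t₂ := by positivity
  set t₃ : ℝ := 8 * (2 + δ₂) / (c * δ) with ht₃def
  have ht₃0 : 0 < t₃ := by positivity
  -- `t₂` lets `V` fall by `2 + 2 m` at speed `κ / 2`, `t₃` lets `B` fall by `2 + δ₂` at speed `c δ
  -- / 8`, and `1` covers rounding `t₂` up to the grid.
  refine ⟨t₂ + t₃ + 1, by positivity, η, hη0, h₀, ?_, ?_⟩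
  · exact lt_min one_pos (lt_min (hbbd _ (by positivity))
      (lt_min (hbbd _ (by positivity)) (hbbd _ (by positivity))))
  intro h n u y z s B hh hhh hu hy hz huz huy hzr hs hB hs' hB' j hjn hj
  obtain ⟨hh4, hh1, hh2, hh3⟩ : h < 1 ∧ h < 2 * m * η / b ∧ h < δ / 2 / b ∧ h < δ₂ / 4 / b := by
    simpa only [hh₀def, lt_min_iff] using hhh
  rw [lt_div_iff₀ hb0] at hh1 hh2 hh3
  have hVup : ∀ j < n, s (j + 1) ≤ s j + h * (a + 1) ∧ s (j + 1) + m * B (j + 1) ≤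
      s j + m * B j + h * (a - a * u j - m * d * r + m * d * z j + (1 + m) * η) := by
    intro j hj
    have hs1 := hs' j hj
    have hB1 := mul_le_mul_of_nonneg_left (hB' j hj) hm.le
    constructor
    · have h1 : a * (1 - u j - y j) - (1 - p) * c * y j + η ≤ a + 1 := by
        have h2 := mul_nonneg ha (hu j)
        have h3 := mul_nonneg ha (hy j)
        have h4 : 0 ≤ (1 - p) * c * y j := mul_nonneg (mul_nonneg (by linarith) hc.le) (hy j)
        linarith
      linarith [mul_le_mul_of_nonneg_left h1 hh.le]
    · have h2 : h * (m * c * y j) = h * ((a + (1 - p) * c) * y j) := by rw [hmc]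
      linarith
  set V : ℕ → ℝ := fun j => max (s j) (s j + m * B j) with hVdef
  have hsV : ∀ j, s j ≤ V j := fun j => le_max_left _ _
  have hLV : ∀ j, s j + m * B j ≤ V j := fun j => le_max_right _ _
  have hV : ∀ j ≤ n, V j ≤ max (V 0 - j * (h * (κ / 2))) (yc - δ + h * b) := by
    intro j hj
    have := le_max_of_drift (V := V) (θ := yc - δ) (δ := h * (κ / 2)) (b := h * b) (k := 0)
      (n := n) (by positivity) ?_ ?_ j (Nat.zero_le j) hj
    · simpa using this
    · intro j _ hj hθ
      obtain ⟨hs1, hL1⟩ := hVup j hj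
      have hsj := abs_le.1 (hs j hj.le)
      have hBj := abs_le.1 (hB j hj.le)
      refine max_le ?_ ?_
      -- If `u` is small, `V` is close to `s`, so `y` is near `yc` or above and `s` decreases.
      -- Otherwise `z = 0` and `s + m B` exceeds `s` by at least `2 m η`, a gap that `s` cannot
      -- close in one step. The branch `s + m B` is treated symmetrically, according to the size of
      -- `z`.
      · by_cases hu3 : u j ≤ 3 * η
        · have hVj : V j ≤ s j + m * (4 * η) := by
            refine max_le (by have := mul_pos hm hη0; linarith) ?_
            have : B j ≤ 4 * η := by linarith [hz j]
            linarith [mul_le_mul_of_nonneg_left this hm.le]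
          have hpu : p * u j ≤ u j := mul_le_of_le_one_left (hu j) hp1
          have hyj : yc - δ - (4 * m + 4) * η ≤ y j := by linarith
          have h1 := mul_le_mul_of_nonneg_left hyj hmc0.le
          have h2 : m * c * yc = m * d * r := by rw [mul_assoc, hyc, mul_assoc]
          have h3 : m * c * y j = (a + (1 - p) * c) * y j := by rw [hmc]
          have h4 := mul_nonneg ha (hu j)
          have h5 : a * (1 - u j - y j) - (1 - p) * c * y j + η ≤ -(κ / 2) := by linarith
          linarith [hs' j hj, hsV j, mul_le_mul_of_nonneg_left h5 hh.le]
        · push Not at hu3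
          have hz0 : z j = 0 := by
            rcases mul_eq_zero.1 (huz j) with h | h
            · linarith
            · exact h
          have h1 : 2 * η ≤ B j := by linarith
          have h2 := mul_le_mul_of_nonneg_left h1 hm.le
          have h3 : a + 1 + κ / 2 ≤ b := by
            have : 0 ≤ c + m * d * (r + 1) + d * (r + 1) + m := by positivity
            linarith
          linarith [mul_le_mul_of_nonneg_left h3 hh.le, hLV j]
      · by_cases hz3 : z j ≤ 3 * η
        · have h1 := mul_le_mul_of_nonneg_left hz3 (mul_pos hm hd).le
          have h2 := mul_nonneg ha (hu j)
          have h3 : a - a * u j - m * d * r + m * d * z j + (1 + m) * η ≤ -(κ / 2) := by linarith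
          linarith [mul_le_mul_of_nonneg_left h3 hh.le, hLV j]
        · push Not at hz3
          have hu0 : u j = 0 := by
            rcases mul_eq_zero.1 (huz j) with h | h
            · exact h
            · linarith
          have h1 : B j ≤ -(2 * η) := by linarith
          have h2 := mul_le_mul_of_nonneg_left h1 hm.le
          have h4 := mul_le_mul_of_nonneg_left (hzr j) (mul_pos hm hd).le
          have h5 : (1 + m) * η ≤ 1 + m := mul_le_of_le_one_right (by positivity) hη1
          have h3 : a - a * u j - m * d * r + m * d * z j + (1 + m) * η + κ / 2 ≤ b := by
            have h6 : 0 ≤ c + d * (r + 1) := by positivity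
            have h7 : 0 ≤ m * d * r := by positivity
            rw [hu0]
            linarith
          linarith [mul_le_mul_of_nonneg_left h3 hh.le, hsV j]
    · intro j _ hj
      obtain ⟨hs1, hL1⟩ := hVup j hj
      refine max_le ?_ ?_
      · have h3 : a + 1 ≤ b := by
          have : 0 ≤ c + m * d * (r + 1) + d * (r + 1) + m := by positivity
          linarith
        linarith [mul_le_mul_of_nonneg_left h3 hh.le, hsV j]
      · have h4 := mul_le_mul_of_nonneg_left (hzr j) (mul_pos hm hd).le
        have h5 : (1 + m) * η ≤ 1 + m := mul_le_of_le_one_right (by positivity) hη1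
        have h8 := mul_nonneg ha (hu j)
        have h3 : a - a * u j - m * d * r + m * d * z j + (1 + m) * η ≤ b := by
          have h6 : 0 ≤ c + d * (r + 1) := by positivity
          have h7 : 0 ≤ m * d * r := by positivity
          linarith
        linarith [mul_le_mul_of_nonneg_left h3 hh.le, hLV j]
  -- the functional is small after the time `t₂`
  have hVsmall : ∀ j ≤ n, t₂ ≤ j * h → V j ≤ yc - δ / 2 := by
    intro j hj hjt
    refine (hV j hj).trans (max_le ?_ (by linarith))
    have h0 : V 0 ≤ 2 + 2 * m := by
      have hs0 := abs_le.1 (hs 0 (Nat.zero_le n))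
      have hB0 := abs_le.1 (hB 0 (Nat.zero_le n))
      have hpu : p * u 0 ≤ u 0 := mul_le_of_le_one_left (hu 0) hp1
      have h1 : B 0 ≤ 2 := by linarith [hz 0, huy 0, hy 0]
      have h2 := mul_le_mul_of_nonneg_left h1 hm.le
      exact max_le (by linarith [huy 0]) (by linarith [huy 0])
    have h1 : t₂ * (κ / 2) = 2 + 2 * m := by rw [ht₂def]; field_simp
    have h2 := mul_le_mul_of_nonneg_right hjt (half_pos hκ0).le
    have h3 : 0 ≤ yc - δ / 2 := by
      have h4 : m * c * yc = κ + a := by rw [mul_assoc, hyc, hκdef]; ring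
      have h5 : m * c * (δ / 2) ≤ m * c * yc := by linarith
      linarith [le_of_mul_le_mul_left h5 hmc0]
    linarith
  -- then the number of idle servers grows
  obtain ⟨k, hk2, hk3⟩ : ∃ k : ℕ, t₂ ≤ k * h ∧ k * h ≤ t₂ + h := by
    refine ⟨⌈t₂ / h⌉₊, ?_, ?_⟩
    · exact (div_le_iff₀ hh).1 (Nat.le_ceil _)
    · have := (Nat.ceil_lt_add_one (div_pos ht₂0 hh).le).le
      have h2 := mul_le_mul_of_nonneg_right this hh.le
      rwa [add_mul, div_mul_cancel₀ _ hh.ne', one_mul] at h2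
  have hkj : k ≤ j := by
    by_contra hlt
    push Not at hlt
    have : (j : ℝ) + 1 ≤ k := by exact_mod_cast hlt
    have := mul_le_mul_of_nonneg_right this hh.le
    linarith
  have hBj := le_max_of_drift (V := B) (θ := -δ₂) (δ := h * (c * δ / 8)) (b := h * b) (k := k)
      (n := n) (by positivity) ?_ ?_ j hkj hjn
  · have hBneg : B j ≤ -(δ₂ / 2) := by
      refine hBj.trans (max_le ?_ (by linarith))
      have hB0 := abs_le.1 (hB k (hkj.trans hjn))
      have h1 : t₃ * (c * δ / 8) = 2 + δ₂ := by rw [ht₃def]; field_simp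
      have h2 : t₃ ≤ (j - k : ℝ) * h := by linarith
      have h3 := mul_le_mul_of_nonneg_right h2 (show 0 ≤ c * δ / 8 by positivity)
      linarith [hz k, huy k, hy k]
    have hBj := abs_le.1 (hB j hjn)
    rcases mul_eq_zero.1 (huz j) with h | h
    · exact h
    · linarith [hu j]
  · intro i hki hi hθ
    have h1 : t₂ ≤ i * h := hk2.trans
      (mul_le_mul_of_nonneg_right (by exact_mod_cast hki) hh.le)
    have h2 := (hsV i).trans (hVsmall i hi.le h1)
    have hsi := abs_le.1 (hs i hi.le)
    have hBi := abs_le.1 (hB i hi.le)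
    have hpu : 0 ≤ p * u i := mul_nonneg hp0 (hu i)
    have h3 : y i ≤ yc - δ * (3 / 8) := by linarith
    have h4 := mul_le_mul_of_nonneg_left h3 hc.le
    -- While `B ≥ -δ₂`, level 2 is almost full, so its output is close to `d r` and exceeds the
    -- inflow.
    have h5 : z i ≤ δ₂ + η := by
      rcases mul_eq_zero.1 (huz i) with h | h <;> linarith
    have h6 := mul_le_mul_of_nonneg_left h5 hd.le
    have h7 : c * y i - d * (r - z i) + η ≤ -(c * δ / 8) := by
      have : 0 < c * δ := by positivity
      linarith
    linarith [hB' i hi, mul_le_mul_of_nonneg_left h7 hh.le]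
  · intro i _ hi
    have h1 : c * y i ≤ c := mul_le_of_le_one_right hc.le (by linarith [hu i, huy i])
    have h2 := mul_le_mul_of_nonneg_left (hzr i) hd.le
    have h3 : c * y i - d * (r - z i) + η ≤ b := by
      have h6 : 0 ≤ m * d * (r + 1) + d * r := by positivity
      linarith
    linarith [hB' i hi, mul_le_mul_of_nonneg_left h3 hh.le]

end Deterministic

/-! ### Sampling in time and dyadic grids -/

section Grid

variable {S : Type*} [Fintype S] [DecidableEq S]

theorem IsMarkovJumpProcess.isMarkovChain {Ω : Type*} [MeasurableSpace Ω] [MeasurableSpace S]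
    {q : S → S → ℝ} {x₀ : S} {P : Measure Ω} {X : ℝ≥0 → Ω → S}
    (hX : IsMarkovJumpProcess q x₀ P X) (h : ℝ≥0) :
    IsMarkovChain (transitionMatrix q h) x₀ P (fun j => X (j * h)) where
  measurable j := hX.measurable _
  finite_dimensional n x := by
    have := hX.finite_dimensional n (fun j => j * h)
      (fun i j hij => mul_le_mul_of_nonneg_right (by exact_mod_cast hij) h.2) (by simp) x
    rw [this]
    congr 1
    refine Finset.prod_congr rfl fun i _ => ?_
    congr 1
    push_cast
    rw [add_mul, one_mul, add_tsub_cancel_left]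

/-- Over a short time span, the conditional mean and variance of a function of a Markov jump
process are given by the rates. -/
theorem eventually_transitionMatrix_mean_variance {q : S → S → ℝ} (f : S → ℝ)
    {σ : ℝ} (hσ : ∀ x, ∑ y, q x y * (f y - f x) ^ 2 ≤ σ) {ε : ℝ} (hε : 0 < ε) :
    ∀ᶠ h : ℝ≥0 in 𝓝 0, ∀ x,
      (transitionMatrix q h).mulVec f x - f x ≤ h * (∑ y, q x y * (f y - f x) + ε) ∧
      ∑ y, transitionMatrix q h x y * (f y - (transitionMatrix q h).mulVec f x) ^ 2 ≤
        h * (σ + 1) := by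
  have h2 : ∀ᶠ h : ℝ≥0 in 𝓝 0, ∀ x' x, |(transitionMatrix q h).mulVec (fun y => (f y - f x') ^ 2) x
      - (f x - f x') ^ 2 - h * (generator q).mulVec (fun y => (f y - f x') ^ 2) x| ≤ 1 * h := by
    rw [eventually_all]
    intro x'
    exact eventually_transitionMatrix_mulVec_le q _ one_pos
  filter_upwards [eventually_transitionMatrix_mulVec_le q f hε, h2] with h hh1 hh2 x
  have h0 : (0 : ℝ) ≤ h := h.2
  constructor
  · have := (abs_le.1 (hh1 x)).2
    rw [generator_mulVec] at this
    linarith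
  · have h3 := (abs_le.1 (hh2 x x)).2
    rw [generator_mulVec] at h3
    simp only [sub_self, ne_eq, OfNat.ofNat_ne_zero, not_false_eq_true, zero_pow, sub_zero] at h3
    have h4 := mul_le_mul_of_nonneg_left (hσ x) h0
    -- The second moment about `f x` is the variance plus the squared shift of the mean.
    have h5 : (transitionMatrix q h).mulVec (fun y => (f y - f x) ^ 2) x =
        ∑ y, transitionMatrix q h x y * (f y - (transitionMatrix q h).mulVec f x) ^ 2 +
          ((transitionMatrix q h).mulVec f x - f x) ^ 2 := by
      set k := (transitionMatrix q h).mulVec f x with hk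
      have h6 : ∑ y, transitionMatrix q h x y * f y = k := rfl
      have h7 := sum_transitionMatrix q h x
      have h8 : ∀ y, transitionMatrix q h x y * (f y - f x) ^ 2 =
          transitionMatrix q h x y * (f y - k) ^ 2 +
          (transitionMatrix q h x y * f y * (2 * (k - f x)) +
          transitionMatrix q h x y * (f x ^ 2 - k ^ 2)) := fun y => by ring
      simp only [Matrix.mulVec, dotProduct, h8, Finset.sum_add_distrib, ← Finset.sum_mul, h6, h7]
      ring
    have h9 := sq_nonneg ((transitionMatrix q h).mulVec f x - f x)
    linarith

end Grid

/-- By right continuity, a property of a path fails on a time interval only if it fails on a dyadic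
grid. -/
theorem setOf_not_forall_Icc_subset {S Ω : Type*} {X : ℝ≥0 → Ω → S}
    (hX : ∀ ω, ∀ t, ∀ᶠ s in 𝓝[≥] t, X s ω = X t ω) (Q : S → Prop) {t₁ T : ℝ≥0} (hT : 0 < T) :
    {ω | ∀ t ∈ Set.Icc t₁ T, Q (X t ω)}ᶜ ⊆
      ⋃ n : ℕ, {ω | ∃ j : ℕ, j ≤ 2 ^ n ∧ t₁ ≤ j * (T / 2 ^ n) ∧ ¬ Q (X (j * (T / 2 ^ n)) ω)} := by
  intro ω hω
  simp only [Set.mem_compl_iff, Set.mem_ofPred_eq, not_forall] at hω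
  obtain ⟨t, ⟨ht1, htT⟩, hQ⟩ := hω
  rw [Set.mem_iUnion]
  -- A grid point just after `t` may exceed `T` when `t = T`, but `T` itself lies on the coarsest
  -- grid.
  rcases htT.eq_or_lt with rfl | hlt
  · exact ⟨0, 1, by simp, by simpa using ht1, by simpa using hQ⟩
  · obtain ⟨v, hv, hsub⟩ := (mem_nhdsGE_iff_exists_Ico_subset' hlt).1 (hX ω t)
    have hlim : Tendsto (fun n : ℕ => t + T / 2 ^ n) atTop (𝓝 t) := by
      have h1 : Tendsto (fun n : ℕ => T / 2 ^ n) atTop (𝓝 0) := by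
        rw [← NNReal.tendsto_coe]
        push_cast
        exact tendsto_const_nhds.div_atTop (tendsto_pow_atTop_atTop_of_one_lt one_lt_two)
      simpa using tendsto_const_nhds.add h1
    obtain ⟨n, hn⟩ := (hlim.eventually (gt_mem_nhds (lt_min hv hlt))).exists
    set h : ℝ≥0 := T / 2 ^ n with hh
    have hh0 : 0 < h := by positivity
    have hj1 : t ≤ ⌈t / h⌉₊ * h := (div_le_iff₀ hh0).1 (Nat.le_ceil _)
    have hj2 : ⌈t / h⌉₊ * h < t + h := by
      have := mul_lt_mul_of_pos_right (Nat.ceil_lt_add_one (zero_le (a := t / h))) hh0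
      rwa [add_mul, div_mul_cancel₀ _ hh0.ne', one_mul] at this
    have hj3 := hj2.trans hn
    refine ⟨n, ⌈t / h⌉₊, ?_, ht1.trans hj1, ?_⟩
    · have h3 : (⌈t / h⌉₊ : ℝ≥0) * h < (2 ^ n : ℕ) * h := by
        have : ((2 ^ n : ℕ) : ℝ≥0) * h = T := by
          rw [hh]; push_cast; field_simp
        rw [this]
        exact hj3.trans_le (min_le_right _ _)
      exact_mod_cast (lt_of_mul_lt_mul_right h3 hh0.le).le
    · have := hsub ⟨hj1, hj3.trans_le (min_le_left _ _)⟩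
      rwa [show X (⌈t / h⌉₊ * h) ω = X t ω from this]

/-- Point `j` of one grid is point `2 j` of the next. -/
theorem monotone_dyadic_grid {S Ω : Type*} (X : ℝ≥0 → Ω → S) (Q : S → Prop) (t₁ T : ℝ≥0) :
    Monotone fun n : ℕ =>
      {ω | ∃ j : ℕ, j ≤ 2 ^ n ∧ t₁ ≤ j * (T / 2 ^ n) ∧ ¬ Q (X (j * (T / 2 ^ n)) ω)} := by
  refine monotone_nat_of_le_succ fun n => ?_
  rintro ω ⟨j, hj, hj1, hj2⟩
  have h : ((j * 2 : ℕ) : ℝ≥0) * (T / 2 ^ (n + 1)) = j * (T / 2 ^ n) := by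
    push_cast; rw [pow_succ]; field_simp
  exact ⟨j * 2, by rw [pow_succ]; omega, by rwa [h], by rwa [h]⟩

/-! ### Probability of blocking on a fine grid -/

section CallCenterProcess

theorem sum_jumpRate_coe (p μ₀₁ μ₁₁ μ₀₂ : ℝ) {C₁ C₂ : ℕ} (x : stateSpace C₁ C₂)
    (g : ℕ × ℕ × ℕ → ℝ) :
    ∑ y : stateSpace C₁ C₂, jumpRate p μ₀₁ μ₁₁ μ₀₂ C₁ C₂ x.1 y.1 * g y.1 =
      ∑ b ∈ stateSpace C₁ C₂, jumpRate p μ₀₁ μ₁₁ μ₀₂ C₁ C₂ x.1 b * g b :=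
  Finset.sum_coe_sort (stateSpace C₁ C₂) fun b => jumpRate p μ₀₁ μ₁₁ μ₀₂ C₁ C₂ x.1 b * g b

/-- After a time that depends only on the parameters, blocked jobs on a fine time grid are
unlikely. -/
theorem exists_time_eventually_grid_le {p μ₀₁ μ₁₁ μ₀₂ r : ℝ} (hp : p ∈ Set.Icc (0 : ℝ) 1)
    (hμ₀₁ : 0 < μ₀₁) (hμ₁₁ : 0 < μ₁₁) (hμ₀₂ : 0 < μ₀₂) (hr : 0 < r)
    (hunder : criticalRatio p μ₀₁ μ₁₁ μ₀₂ < r) :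
    ∃ t₁ : ℝ≥0, 0 < t₁ ∧ ∃ η > 0, ∀ (N C₂ : ℕ), 0 < N → |(C₂ : ℝ) / N - r| ≤ η →
      ∀ (x₀ : stateSpace N C₂) {Ω : Type*} [MeasurableSpace Ω] (P : Measure Ω)
        [IsProbabilityMeasure P] (X : ℝ≥0 → Ω → stateSpace N C₂),
        IsCallCenterProcess p μ₀₁ μ₁₁ μ₀₂ N C₂ x₀ P X → ∀ T : ℝ≥0, 0 < T →
        ∀ᶠ n : ℕ in atTop, P.real {ω | ∃ j : ℕ, j ≤ 2 ^ n ∧ t₁ ≤ j * (T / 2 ^ n) ∧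
          ¬ blocked (X (j * (T / 2 ^ n)) ω) = 0} ≤
          2 * (T * ((μ₀₁ + μ₁₁) * N + μ₀₂ * C₂ + 1) / (η * N) ^ 2) := by
  obtain ⟨hp0, hp1⟩ := id hp
  have hm : 0 < μ₁₁ * p / μ₀₁ + (1 - p) := by
    rcases hp0.eq_or_lt with rfl | hp0
    · simp
    · have : 0 < μ₁₁ * p / μ₀₁ := by positivity
      linarith
  have hκ : μ₁₁ * p < (μ₁₁ * p / μ₀₁ + (1 - p)) * μ₀₂ * r := by
    have h1 : p / μ₀₁ + (1 - p) / μ₁₁ = (μ₁₁ * p / μ₀₁ + (1 - p)) / μ₁₁ := by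
      field_simp
    rw [criticalRatio, h1, div_lt_iff₀ (by positivity), div_lt_iff₀ hμ₀₂] at hunder
    have h2 := mul_lt_mul_of_pos_right hunder hμ₁₁
    have h3 : r * ((μ₁₁ * p / μ₀₁ + (1 - p)) / μ₁₁) * μ₀₂ * μ₁₁ =
      (μ₁₁ * p / μ₀₁ + (1 - p)) * μ₀₂ * r := by field_simp
    linarith
  obtain ⟨t₁, ht₁, η, hη, h₀, hh₀, hdet⟩ := exists_time_forall_blocked_eq_zero
    (mul_nonneg hμ₁₁.le hp0) hμ₀₁ hμ₀₂ hp hr hm hκ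
  -- The bound `1` gives `z ≤ r + 1`. The bound `η / (2 * μ₀₂)` lets `r` replace `C₂ / N` at the
  -- cost of half the tolerance; the time discretisation uses the other half.
  refine ⟨⟨t₁, ht₁.le⟩, ht₁, min η (min 1 (η / (2 * μ₀₂))), by positivity, ?_⟩
  intro N C₂ hN hC x₀ Ω _ P _ X hX T hT
  have hN' : (0 : ℝ) < N := by exact_mod_cast hN
  set η' : ℝ := min η (min 1 (η / (2 * μ₀₂))) with hη'
  have hη'0 : 0 < η' := by positivity
  set q : stateSpace N C₂ → stateSpace N C₂ → ℝ :=
    fun a b => jumpRate p μ₀₁ μ₁₁ μ₀₂ N C₂ a.1 b.1 with hq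
  set R : ℝ := (μ₀₁ + μ₁₁) * N + μ₀₂ * C₂ with hR
  have hR0 : 0 ≤ R := by positivity
  set fs : stateSpace N C₂ → ℝ := fun x => urgentLoad p x.1 with hfs
  set fB : stateSpace N C₂ → ℝ := fun x => imbalance x.1 with hfB
  have hσs : ∀ x, ∑ y, q x y * (fs y - fs x) ^ 2 ≤ R := by
    intro x
    refine (sum_jumpRate_coe p μ₀₁ μ₁₁ μ₀₂ x fun b => (urgentLoad p b - urgentLoad p x.1) ^ 2).trans_le
      (sum_jumpRate_mul_le hp hμ₀₁ hμ₁₁ hμ₀₂ x.2 fun b _ hb0 => ?_)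
    exact (sq_le_one_iff_abs_le_one _).2 (abs_sub_le_one_of_jumpRate_ne_zero hp hb0 x.2).1
  have hσB : ∀ x, ∑ y, q x y * (fB y - fB x) ^ 2 ≤ R := by
    intro x
    refine (sum_jumpRate_coe p μ₀₁ μ₁₁ μ₀₂ x fun b => (imbalance b - imbalance x.1) ^ 2).trans_le
      (sum_jumpRate_mul_le hp hμ₀₁ hμ₁₁ hμ₀₂ x.2 fun b _ hb0 => ?_)
    exact (sq_le_one_iff_abs_le_one _).2 (abs_sub_le_one_of_jumpRate_ne_zero hp hb0 x.2).2
  have hgs : ∀ x, ∑ y, q x y * (fs y - fs x) =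
      μ₁₁ * p * (N - blocked x - inService x) - (1 - p) * μ₀₁ * inService x := fun x =>
    (sum_jumpRate_coe p μ₀₁ μ₁₁ μ₀₂ x fun b => urgentLoad p b - urgentLoad p x.1).trans
      (sum_jumpRate_mul_urgentLoad p μ₀₁ μ₁₁ μ₀₂ x.2)
  have hgB : ∀ x, ∑ y, q x y * (fB y - fB x) =
      μ₀₁ * inService x - μ₀₂ * (C₂ - idle x) := fun x =>
    (sum_jumpRate_coe p μ₀₁ μ₁₁ μ₀₂ x fun b => imbalance b - imbalance x.1).trans
      (sum_jumpRate_mul_imbalance p μ₀₁ μ₁₁ μ₀₂ x.2)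
  have hlim : Tendsto (fun n : ℕ => T / 2 ^ n) atTop (𝓝 0) := by
    rw [← NNReal.tendsto_coe]
    push_cast
    exact tendsto_const_nhds.div_atTop (tendsto_pow_atTop_atTop_of_one_lt one_lt_two)
  have hε : 0 < η / 2 * N := by positivity
  filter_upwards [hlim.eventually (eventually_transitionMatrix_mean_variance fs hσs hε),
    hlim.eventually (eventually_transitionMatrix_mean_variance fB hσB hε),
    hlim.eventually (gt_mem_nhds (show (0 : ℝ≥0) < ⟨h₀, hh₀.le⟩ from hh₀))] with n hns hnB hnh
  set h : ℝ≥0 := T / 2 ^ n with hh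
  have hh0 : (0 : ℝ) < h := by
    have : 0 < h := by positivity
    exact this
  have hhT : ((2 ^ n : ℕ) : ℝ) * h = T := by
    rw [hh]; push_cast; field_simp
  have hchain := hX.isMarkovChain h
  set K := transitionMatrix q h with hKdef
  have hl : 0 < η' * N := by positivity
  have hK1 := sum_transitionMatrix q h
  have hprobs := hchain.kolmogorov hK1 fs (by positivity) (fun x => (hns x).2) hl (2 ^ n)
  have hprobB := hchain.kolmogorov hK1 fB (by positivity) (fun x => (hnB x).2) hl (2 ^ n)
  -- There are `2 ^ n` steps of variance at most `h (R + 1)`, so the mesh cancels.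
  rw [← mul_assoc, hhT] at hprobs hprobB
  rw [two_mul]
  refine le_trans ?_ (add_le_add hprobs hprobB)
  refine le_trans (measureReal_mono ?_) (measureReal_union_le _ _)
  rintro ω ⟨j, hj, hjt, hjb⟩
  by_contra hgood
  simp only [Set.mem_union, Set.mem_ofPred_eq, not_or, not_exists, not_and, not_le] at hgood
  obtain ⟨hgs', hgB'⟩ := hgood
  set w : ℕ → stateSpace N C₂ := fun k => X (k * h) ω with hw
  set Ms : ℕ → ℝ := fun j => ∑ i ∈ Finset.range j, martingaleIncrement K fs w i with hMs
  set MB : ℕ → ℝ := fun j => ∑ i ∈ Finset.range j, martingaleIncrement K fB w i with hMB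
  have hC1 := abs_le.1 (hC.trans ((min_le_right _ _).trans (min_le_left _ _)))
  have hC2 := abs_le.1 (hC.trans ((min_le_right _ _).trans (min_le_right _ _)))
  have hCd : μ₀₂ * (r - C₂ / N) ≤ η / 2 := by
    have h1 : r - C₂ / N ≤ η / (2 * μ₀₂) := by linarith
    have h2 := mul_le_mul_of_nonneg_left h1 hμ₀₂.le
    have h3 : μ₀₂ * (η / (2 * μ₀₂)) = η / 2 := by field_simp
    linarith
  have herr : ∀ {m : ℝ}, |m| < η' * N → |m / N| ≤ η := by
    intro m hm
    rw [abs_div, abs_of_pos hN', div_le_iff₀ hN']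
    exact hm.le.trans (mul_le_mul_of_nonneg_right (min_le_left _ _) hN'.le)
  have hstate : ∀ i, inService (w i) + blocked (w i) ≤ N ∧ idle (w i) ≤ C₂ ∧
      blocked (w i) * idle (w i) = 0 := fun i => mem_stateSpace.1 (w i).2
  -- The functionals minus their martingale parts change only by the conditional mean increments.
  have hzero := hdet h (2 ^ n) (fun i => blocked (w i) / N) (fun i => inService (w i) / N)
    (fun i => idle (w i) / N) (fun i => (fs (w i) - Ms i) / N) (fun i => (fB (w i) - MB i) / N)
    hh0 hnh (fun i => by positivity) (fun i => by positivity) (fun i => by positivity)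
    (fun i => ?_) (fun i => ?_) (fun i => ?_) (fun i hi => ?_) (fun i hi => ?_) (fun i hi => ?_)
    (fun i hi => ?_) j hj hjt
  · rw [div_eq_zero_iff] at hzero
    rcases hzero with h | h
    · exact hjb (by exact_mod_cast h)
    · exact hN'.ne' h
  · rw [div_mul_div_comm, ← Nat.cast_mul, (hstate i).2.2]
    simp
  · rw [← add_div, div_le_one hN', add_comm]
    exact_mod_cast (hstate i).1
  · have : (idle (w i) : ℝ) ≤ C₂ := by exact_mod_cast (hstate i).2.1
    have h2 := div_le_div_of_nonneg_right this hN'.le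
    linarith
  · have h1 : (fs (w i) - Ms i) / N - (inService (w i) / N + p * (blocked (w i) / N)) =
        -(Ms i / N) := by
      simp only [hfs, urgentLoad]; field_simp; ring
    simp only [h1, abs_neg]
    exact herr (hgs' i hi)
  · have h1 : (fB (w i) - MB i) / N - (blocked (w i) / N - idle (w i) / N) = -(MB i / N) := by
      simp only [hfB, imbalance]; field_simp; ring
    simp only [h1, abs_neg]
    exact herr (hgB' i hi)
  · have h1 := (hns (w i)).1
    rw [hgs] at h1
    have h2 : fs (w (i + 1)) - Ms (i + 1) = fs (w i) - Ms i + (K.mulVec fs (w i) - fs (w i)) := by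
      simp only [hMs, Finset.sum_range_succ, martingaleIncrement]; ring
    simp only [h2]
    rw [div_le_iff₀ hN']
    have h3 : ((fs (w i) - Ms i) / N + h * (μ₁₁ * p * (1 - blocked (w i) / N - inService (w i) / N)
        - (1 - p) * μ₀₁ * (inService (w i) / N) + η)) * N = fs (w i) - Ms i +
        h * (μ₁₁ * p * (N - blocked (w i) - inService (w i)) - (1 - p) * μ₀₁ * inService (w i)
          + η * N) := by field_simp
    rw [h3]
    have h4 : 0 ≤ h * (η / 2 * N) := by positivity
    linarith
  · have h1 := (hnB (w i)).1
    rw [hgB] at h1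
    have h2 : fB (w (i + 1)) - MB (i + 1) = fB (w i) - MB i + (K.mulVec fB (w i) - fB (w i)) := by
      simp only [hMB, Finset.sum_range_succ, martingaleIncrement]; ring
    simp only [h2]
    rw [div_le_iff₀ hN']
    have h3 : ((fB (w i) - MB i) / N + h * (μ₀₁ * (inService (w i) / N)
        - μ₀₂ * (r - idle (w i) / N) + η)) * N = fB (w i) - MB i +
        h * (μ₀₁ * inService (w i) - μ₀₂ * (r * N - idle (w i)) + η * N) := by field_simp
    rw [h3]
    have h4 : μ₀₂ * (r * N - C₂) ≤ η / 2 * N := by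
      have h5 := mul_le_mul_of_nonneg_right hCd hN'.le
      have h6 : μ₀₂ * (r - C₂ / N) * N = μ₀₂ * (r * N - C₂) := by field_simp
      linarith
    have h7 := mul_le_mul_of_nonneg_left h4 hh0.le
    linarith

end CallCenterProcess

end CallCenter

/-! ### Limit of large call centers -/

theorem mainTheorem3
    (p μ₀₁ μ₁₁ μ₀₂ r : ℝ) (hp : p ∈ Set.Icc (0 : ℝ) 1)
    (hμ₀₁ : 0 < μ₀₁) (hμ₁₁ : 0 < μ₁₁) (hμ₀₂ : 0 < μ₀₂) (hr : 0 < r)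
    (C₂ : ℕ → ℕ) (hC₂ : Tendsto (fun N : ℕ => (C₂ N : ℝ) / (N : ℝ)) atTop (𝓝 r))
    (hunder : CallCenter.criticalRatio p μ₀₁ μ₁₁ μ₀₂ < r) :
    ∃ t₁ : ℝ≥0, 0 < t₁ ∧
      ∀ (x₀ : ∀ N : ℕ, CallCenter.stateSpace N (C₂ N)) (fluid : ℝ × ℝ × ℝ),
        fluid ∈ Set.Icc (0 : ℝ) 1 ×ˢ Set.Icc (0 : ℝ) 1 ×ˢ Set.Icc (0 : ℝ) r →
        Tendsto (fun N : ℕ => (((CallCenter.blocked (x₀ N) : ℝ) / (N : ℝ),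
            (CallCenter.inService (x₀ N) : ℝ) / (N : ℝ),
            (CallCenter.idle (x₀ N) : ℝ) / (N : ℝ)) : ℝ × ℝ × ℝ)) atTop (𝓝 fluid) →
        ∀ (Ω : ℕ → Type*) (_ : ∀ N, MeasurableSpace (Ω N))
          (P : ∀ N, Measure (Ω N)) (_ : ∀ N, IsProbabilityMeasure (P N))
          (X : ∀ N, ℝ≥0 → Ω N → CallCenter.stateSpace N (C₂ N)),
          (∀ N, CallCenter.IsCallCenterProcess p μ₀₁ μ₁₁ μ₀₂ N (C₂ N) (x₀ N) (P N) (X N)) →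
          ∀ T : ℝ≥0, t₁ < T →
            Tendsto (fun N : ℕ =>
                P N {ω | ∀ t ∈ Set.Icc t₁ T, CallCenter.blocked (X N t ω) = 0})
              atTop (𝓝 1) := by
  obtain ⟨t₁, ht₁, η, hη, hgrid⟩ :=
    CallCenter.exists_time_eventually_grid_le hp hμ₀₁ hμ₁₁ hμ₀₂ hr hunder
  refine ⟨t₁, ht₁, ?_⟩
  intro x₀ fluid _ _ Ω _ P _ X hX T hT
  have hT0 : 0 < T := ht₁.trans hT
  set b : ℕ → ℝ := fun N =>
    2 * (T * ((μ₀₁ + μ₁₁) * N + μ₀₂ * C₂ N + 1) / (η * N) ^ 2) with hb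
  have hblim : Tendsto b atTop (𝓝 0) := by
    have hinv : Tendsto (fun N : ℕ => ((N : ℝ))⁻¹) atTop (𝓝 0) :=
      tendsto_inv_atTop_zero.comp tendsto_natCast_atTop_atTop
    have h1 : Tendsto (fun N : ℕ => 2 * T / η ^ 2 *
        ((μ₀₁ + μ₁₁ + μ₀₂ * ((C₂ N : ℝ) / N) + (N : ℝ)⁻¹) * (N : ℝ)⁻¹)) atTop
        (𝓝 (2 * T / η ^ 2 * ((μ₀₁ + μ₁₁ + μ₀₂ * r + 0) * 0))) :=
      (((tendsto_const_nhds.add (hC₂.const_mul μ₀₂)).add hinv).mul hinv).const_mul _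
    rw [mul_zero, mul_zero] at h1
    refine h1.congr' ?_
    filter_upwards [eventually_gt_atTop 0] with N hN
    have : (N : ℝ) ≠ 0 := by positivity
    simp only [hb]
    field_simp
  have hsmall : ∀ᶠ N : ℕ in atTop,
      P N {ω | ∀ t ∈ Set.Icc t₁ T, CallCenter.blocked (X N t ω) = 0}ᶜ ≤ ENNReal.ofReal (b N) := by
    filter_upwards [eventually_gt_atTop 0, hC₂.eventually (Metric.closedBall_mem_nhds r hη)]
      with N hN hCN
    have hgr := hgrid N (C₂ N) hN hCN (x₀ N) (P N) (X N) (hX N) T hT0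
    have hsub := CallCenter.setOf_not_forall_Icc_subset (hX N).right_continuous
      (fun x => CallCenter.blocked x.1 = 0) (t₁ := t₁) hT0
    have hmono := CallCenter.monotone_dyadic_grid (X N)
      (fun x => CallCenter.blocked x.1 = 0) t₁ T
    refine (measure_mono hsub).trans ?_
    -- The grid bound holds only for large `n`; as the events increase with `n`, it holds for all of
    -- them and for their union.
    rw [hmono.measure_iUnion]
    refine iSup_le fun n => ?_
    obtain ⟨k, hk, hnk⟩ := (hgr.and (eventually_ge_atTop n)).exists
    refine (measure_mono (hmono hnk)).trans ?_
    rw [← ofReal_measureReal]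
    exact ENNReal.ofReal_le_ofReal hk
  have hlim : Tendsto (fun N => 1 - ENNReal.ofReal (b N)) atTop (𝓝 1) := by
    have h1 : Tendsto (fun N => ENNReal.ofReal (b N)) atTop (𝓝 0) := by
      simpa using ENNReal.tendsto_ofReal hblim
    simpa using ENNReal.Tendsto.sub (tendsto_const_nhds (x := (1 : ENNReal))) h1 (by simp)
  refine tendsto_of_tendsto_of_tendsto_of_le_of_le' hlim tendsto_const_nhds ?_
    (Eventually.of_forall fun N => prob_le_one)
  filter_upwards [hsmall] with N hN
  rw [tsub_le_iff_right]
  calc (1 : ENNReal) = P N Set.univ := measure_univ.symm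
    _ ≤ P N {ω | ∀ t ∈ Set.Icc t₁ T, CallCenter.blocked (X N t ω) = 0} +
        P N {ω | ∀ t ∈ Set.Icc t₁ T, CallCenter.blocked (X N t ω) = 0}ᶜ := by
      rw [← Set.union_compl_self {ω | ∀ t ∈ Set.Icc t₁ T, CallCenter.blocked (X N t ω) = 0}]
      exact measure_union_le _ _
    _ ≤ _ := by gcongr
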